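/- \textbf{Theorem (general representation theorem, Chernoff product formula).} Let $\mathcal E$ be a complex Banach space with identity operator $I$, and let $\{F(t)\}_{t\ge 0}$ be a family of bounded linear operators on $\mathcal E$ with $F(0)=I$. Suppose that there are $\omega\ge 0$ and $M\ge 1$ such that $$\|F(t)^k\|\le M e^{k\omega t}\qquad\text{for all } t\ge 0 \text{ and all integers } k\ge 1 .$$ Let $A$, with domain $D(A)$, be the infinitesimal generator of a $C_0$-semigroup $\{T(t)\}_{t\ge 0}$ of bounded linear operators on $\mathcal E$; that is, $T(0)=I$, $T(t+s)=T(t)T(s)$ for all $t,s\ge 0$, $\lim_{t\searrow 0}T(t)x=x$ for all $x\in\mathcal E$, $D(A)$ is the set of all $x\in\mathcal E$ for which $\lim_{t\searrow 0}\frac{T(t)x-x}{t}$ exists, and $Ax$ is this limit. Suppose that $$\lim_{t\searrow 0}\frac{F(t)x-x}{t}=Ax\qquad\text{for all } x\in D(A).$$ Then $$T(t)x=\lim_{n\to\infty}\left[F\!\left(\tfrac{t}{n}\right)\right]^n x\qquad\text{for all } x\in\mathcal E,$$ uniformly with respect to $t$ on the compact intervals of $[0,\infty)$. -/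

import Mathlib

open Filter Topology
open scoped NNReal

namespace C0

variable {E : Type*} [NormedAddCommGroup E] [NormedSpace ℂ E]

/-- A `C₀`-semigroup (strongly continuous one-parameter semigroup) of bounded linear operators
on `E`, as a family indexed by the nonnegative reals. -/
structure IsC0Semigroup (T : ℝ≥0 → E →L[ℂ] E) : Prop where
  zero : T 0 = ContinuousLinearMap.id ℂ E
  add : ∀ t s : ℝ≥0, T (t + s) = (T t).comp (T s)
  tendsto : ∀ x : E, Tendsto (fun t : ℝ≥0 => T t x) (𝓝[>] 0) (𝓝 x)

/-- The difference quotient `(S(t) x - x) / t` of a family of bounded operators. -/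
noncomputable def diffQuot (S : ℝ≥0 → E →L[ℂ] E) (x : E) (t : ℝ≥0) : E :=
  (t : ℝ)⁻¹ • (S t x - x)

theorem diffQuot_add (S : ℝ≥0 → E →L[ℂ] E) (x y : E) :
    diffQuot S (x + y) = fun t => diffQuot S x t + diffQuot S y t := by
  funext t
  simp only [diffQuot, map_add, ← smul_add]
  congr 1
  abel

theorem diffQuot_smul (S : ℝ≥0 → E →L[ℂ] E) (c : ℂ) (x : E) :
    diffQuot S (c • x) = fun t => c • diffQuot S x t := by
  funext t
  simp only [diffQuot, map_smul, ← smul_sub]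
  exact smul_comm _ _ _

/-- The space of all `x` for which `(T(t) x - x) / t` converges in `E` as `t ↘ 0`. -/
def generatorDomain (T : ℝ≥0 → E →L[ℂ] E) : Submodule ℂ E where
  carrier := {x | ∃ y : E, Tendsto (diffQuot T x) (𝓝[>] 0) (𝓝 y)}
  add_mem' := by
    rintro a b ⟨y, hy⟩ ⟨z, hz⟩
    exact ⟨y + z, by rw [diffQuot_add]; exact hy.add hz⟩
  zero_mem' := ⟨0, by
    have h : diffQuot T (0 : E) = fun _ => 0 := by
      funext t
      simp [diffQuot]
    rw [h]
    exact tendsto_const_nhds⟩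
  smul_mem' := by
    rintro c a ⟨y, hy⟩
    exact ⟨c • y, by rw [diffQuot_smul]; exact hy.const_smul c⟩

/-- The infinitesimal generator of `T`: the (in general unbounded) linear operator with domain
`generatorDomain T` that sends `x` to the limit of `(T(t) x - x) / t` as `t ↘ 0`. -/
noncomputable def generator (T : ℝ≥0 → E →L[ℂ] E) : E →ₗ.[ℂ] E where
  domain := generatorDomain T
  toFun :=
    { toFun := fun x => Classical.choose x.2
      map_add' := fun x y => by
        refine tendsto_nhds_unique (Classical.choose_spec (x + y).2) ?_
        rw [Submodule.coe_add, diffQuot_add]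
        exact (Classical.choose_spec x.2).add (Classical.choose_spec y.2)
      map_smul' := fun c x => by
        refine tendsto_nhds_unique (Classical.choose_spec (c • x).2) ?_
        rw [Submodule.coe_smul, diffQuot_smul]
        exact (Classical.choose_spec x.2).const_smul c }

theorem mem_generator_domain (T : ℝ≥0 → E →L[ℂ] E) (x : E) :
    x ∈ (generator T).domain ↔ ∃ y : E, Tendsto (diffQuot T x) (𝓝[>] 0) (𝓝 y) :=
  Iff.rfl

theorem tendsto_generator (T : ℝ≥0 → E →L[ℂ] E) (x : (generator T).domain) :
    Tendsto (diffQuot T (x : E)) (𝓝[>] 0) (𝓝 (generator T x)) :=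
  Classical.choose_spec x.2

end C0

/-! For `z` in the domain, `F(t/n)^n z - T(t/n)^n z` telescopes into `n` terms. Each is a power of
`F(t/n)`, bounded by stability, applied to `(F - T)(t/n)` at a point of the orbit of `z`. If these
differences are `o(t/n)` uniformly along the orbit, the sum tends to 0. That uniformity is the crux
(`eventually_norm_sub_le`). The operators `(F(h) - T(h))/h` are bounded on the graph of `A`, a
Banach space because `A` is closed, and tend to 0 pointwise there. By Banach–Steinhaus they do so
uniformly on compact sets, such as `{(T(s)z, T(s)Az) : s ≤ b}`. Density of the domain and the
uniform bounds on both families then give every `x`. -/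

/-! ### Uniform boundedness and compactness -/

/-- A family of bounded operators that converges pointwise along a countably generated filter is
eventually bounded in norm. -/
theorem exists_eventually_norm_le_of_tendsto {ι G E : Type*} [NormedAddCommGroup G]
    [NormedSpace ℂ G] [CompleteSpace G] [NormedAddCommGroup E] [NormedSpace ℂ E]
    {l : Filter ι} [l.IsCountablyGenerated] {L : ι → G →L[ℂ] E} {f : G → E}
    (hL : ∀ g, Tendsto (fun i => L i g) l (𝓝 (f g))) :
    ∃ C : ℝ, 0 < C ∧ ∀ᶠ i in l, ‖L i‖ ≤ C := by
  by_contra! hcon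
  -- Along a filter, convergence bounds orbits only eventually, whereas a convergent sequence is
  -- bounded; hence a sequence with norms blowing up.
  obtain ⟨s, hs⟩ := l.exists_antitone_basis
  have key : ∀ n : ℕ, ∃ i ∈ s n, (n : ℝ) + 1 < ‖L i‖ := by
    intro n
    by_contra! hn
    refine hcon (n + 1) (by positivity) ?_
    filter_upwards [hs.mem n] with i hi using not_lt.2 (hn i hi)
  choose i his hi using key
  have hil : Tendsto i atTop l := hs.tendsto his
  obtain ⟨C, hC⟩ := banach_steinhaus (g := fun n => L (i n)) (fun x => by
    obtain ⟨C, hC⟩ := (((hL x).comp hil).norm).bddAbove_range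
    exact ⟨C, fun n => hC ⟨n, rfl⟩⟩)
  obtain ⟨n, hn⟩ := exists_nat_gt C
  linarith [hi n, hC n]

/-- Pointwise convergence to zero of bounded operators is uniform on compact sets. -/
theorem eventually_forall_norm_lt_of_isCompact {ι G E : Type*} [NormedAddCommGroup G]
    [NormedSpace ℂ G] [CompleteSpace G] [NormedAddCommGroup E] [NormedSpace ℂ E]
    {l : Filter ι} [l.IsCountablyGenerated] {L : ι → G →L[ℂ] E}
    (hL : ∀ g, Tendsto (fun i => L i g) l (𝓝 0)) {K : Set G} (hK : IsCompact K)
    {ε : ℝ} (hε : 0 < ε) : ∀ᶠ i in l, ∀ g ∈ K, ‖L i g‖ < ε := by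
  obtain ⟨C, hC, hLC⟩ := exists_eventually_norm_le_of_tendsto hL
  obtain ⟨t, -, htfin, ht⟩ := hK.finite_cover_balls (e := ε / (2 * C)) (by positivity)
  have hpt : ∀ᶠ i in l, ∀ y ∈ t, ‖L i y‖ < ε / 2 := by
    rw [eventually_all_finite htfin]
    intro y _
    have := (hL y).norm
    rw [norm_zero] at this
    exact this.eventually_lt_const (by positivity)
  filter_upwards [hLC, hpt] with i hi hit g hg
  obtain ⟨y, hy, hgy⟩ := Set.mem_iUnion₂.1 (ht hg)
  rw [Metric.mem_ball, dist_eq_norm] at hgy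
  calc ‖L i g‖ = ‖L i (g - y) + L i y‖ := by rw [← map_add, sub_add_cancel]
    _ ≤ ‖L i (g - y)‖ + ‖L i y‖ := norm_add_le _ _
    _ < C * (ε / (2 * C)) + ε / 2 := by
        refine add_lt_add_of_le_of_lt ?_ (hit y hy)
        exact (L i).le_of_opNorm_le_of_le hi hgy.le
    _ = ε := by field_simp; norm_num

theorem tendsto_toNNReal_nhdsGT_zero :
    Tendsto Real.toNNReal (𝓝[>] (0 : ℝ)) (𝓝[>] (0 : ℝ≥0)) := by
  refine tendsto_nhdsWithin_iff.2 ⟨?_, ?_⟩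
  · have := (continuous_real_toNNReal.tendsto (0 : ℝ)).mono_left (nhdsWithin_le_nhds (s := Set.Ioi 0))
    rwa [Real.toNNReal_zero] at this
  · filter_upwards [self_mem_nhdsWithin] with h hh using Real.toNNReal_pos.2 hh

theorem tendsto_coe_nhdsGT_zero :
    Tendsto ((↑) : ℝ≥0 → ℝ) (𝓝[>] (0 : ℝ≥0)) (𝓝[>] (0 : ℝ)) := by
  refine tendsto_nhdsWithin_iff.2 ⟨?_, ?_⟩
  · exact (NNReal.continuous_coe.tendsto (0 : ℝ≥0)).mono_left nhdsWithin_le_nhds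
  · filter_upwards [self_mem_nhdsWithin] with h hh using NNReal.coe_pos.2 hh

/-! ### Semigroups and their generators -/

namespace C0

section Semigroup

variable {E : Type*} [NormedAddCommGroup E] [NormedSpace ℂ E] {T : ℝ≥0 → E →L[ℂ] E}

theorem IsC0Semigroup.add_apply (hT : IsC0Semigroup T) (t s : ℝ≥0) (x : E) :
    T (t + s) x = T t (T s x) := by
  rw [hT.add]; rfl

theorem IsC0Semigroup.zero_apply (hT : IsC0Semigroup T) (x : E) : T 0 x = x := by
  rw [hT.zero]; rfl

theorem IsC0Semigroup.natCast_mul (hT : IsC0Semigroup T) (h : ℝ≥0) (n : ℕ) :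
    T (n * h) = T h ^ n := by
  induction n with
  | zero => simp [hT.zero, ContinuousLinearMap.one_def]
  | succ n ih =>
    rw [pow_succ', ← ih, Nat.cast_succ, add_mul, one_mul, add_comm, hT.add]
    rfl

theorem IsC0Semigroup.tendsto_nhds (hT : IsC0Semigroup T) (x : E) :
    Tendsto (fun t : ℝ≥0 => T t x) (𝓝 0) (𝓝 x) := by
  rw [← nhdsWithin_univ]
  have : (Set.univ : Set ℝ≥0) = insert 0 (Set.Ioi 0) := by
    ext t
    simp
  rw [this, nhdsWithin_insert, tendsto_sup]
  have h0 := tendsto_pure_nhds (fun t : ℝ≥0 => T t x) 0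
  rw [hT.zero_apply] at h0
  exact ⟨h0, hT.tendsto x⟩

/-- A `C₀`-semigroup is bounded on bounded time intervals. -/
theorem IsC0Semigroup.exists_norm_le [CompleteSpace E] (hT : IsC0Semigroup T) (b : ℝ≥0) :
    ∃ C : ℝ, 0 < C ∧ ∀ t ≤ b, ‖T t‖ ≤ C := by
  obtain ⟨C, hC, hTC⟩ := exists_eventually_norm_le_of_tendsto (L := T) hT.tendsto_nhds
  obtain ⟨δ, hδ, hball⟩ := Metric.eventually_nhds_iff.1 hTC
  obtain ⟨n, hn⟩ := exists_nat_gt ((b : ℝ) / δ)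
  have hn0 : (0 : ℝ) < n := lt_of_le_of_lt (by positivity) hn
  refine ⟨C ^ n, by positivity, fun t ht => ?_⟩
  have hn' : (n : ℝ≥0) ≠ 0 := by exact_mod_cast hn0.ne'
  have htn : T t = T (t / n) ^ n := by
    rw [← hT.natCast_mul, mul_div_cancel₀ _ hn']
  have hlt : dist (t / n) (0 : ℝ≥0) < δ := by
    rw [NNReal.dist_eq]
    push_cast
    rw [sub_zero, abs_of_nonneg (by positivity), div_lt_iff₀ hn0]
    rw [div_lt_iff₀ hδ] at hn
    have : (t : ℝ) ≤ b := ht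
    linarith
  rw [htn]
  refine (norm_pow_le' _ (by exact_mod_cast hn0)).trans ?_
  exact pow_le_pow_left₀ (norm_nonneg _) (hball hlt) n

theorem IsC0Semigroup.continuous [CompleteSpace E] (hT : IsC0Semigroup T) (x : E) :
    Continuous fun t => T t x := by
  rw [continuous_iff_continuousAt]
  intro t
  obtain ⟨C, hC, hTC⟩ := hT.exists_norm_le (t + 1)
  -- With truncated subtraction `(s - t) + (t - s)` is `|s - t|`, so one bound serves both sides of
  -- `t`.
  have hmain : Tendsto (fun s : ℝ≥0 => C * ‖T ((s - t) + (t - s)) x - x‖) (𝓝 t) (𝓝 0) := by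
    have h1 : Tendsto (fun s : ℝ≥0 => (s - t) + (t - s)) (𝓝 t) (𝓝 0) := by
      have : Continuous fun s : ℝ≥0 => (s - t) + (t - s) := by fun_prop
      simpa using this.tendsto t
    have h2 := (((hT.tendsto_nhds x).comp h1).sub_const x).norm.const_mul C
    simpa using h2
  refine tendsto_iff_norm_sub_tendsto_zero.2 (squeeze_zero' ?_ ?_ hmain)
  · exact Eventually.of_forall fun s => norm_nonneg _
  · filter_upwards [Iio_mem_nhds (lt_add_one t)] with s hs
    rcases le_total s t with h | h
    · have : T t x = T s (T (t - s) x) := by rw [← hT.add_apply, add_tsub_cancel_of_le h]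
      rw [tsub_eq_zero_of_le h, zero_add, this, ← map_sub, norm_sub_rev (T (t - s) x) x]
      exact (T s).le_of_opNorm_le (hTC s hs.le) _
    · have : T s x = T t (T (s - t) x) := by rw [← hT.add_apply, add_tsub_cancel_of_le h]
      rw [tsub_eq_zero_of_le h, add_zero, this, ← map_sub]
      exact (T t).le_of_opNorm_le (hTC t (le_add_of_nonneg_right zero_le_one)) _

theorem IsC0Semigroup.continuous_toNNReal [CompleteSpace E] (hT : IsC0Semigroup T) (x : E) :
    Continuous fun s : ℝ => T s.toNNReal x :=
  (hT.continuous x).comp continuous_real_toNNReal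

/-- The domain of the generator is invariant under the semigroup, which commutes with the
generator there. -/
theorem IsC0Semigroup.tendsto_diffQuot_apply (hT : IsC0Semigroup T) {x y : E}
    (hxy : Tendsto (diffQuot T x) (𝓝[>] 0) (𝓝 y)) (s : ℝ≥0) :
    Tendsto (diffQuot T (T s x)) (𝓝[>] 0) (𝓝 (T s y)) := by
  refine (((T s).continuous.tendsto y).comp hxy).congr fun t => ?_
  simp only [Function.comp, diffQuot, map_sub, ContinuousLinearMap.map_smul_of_tower]
  rw [← hT.add_apply, ← hT.add_apply, add_comm]

/-- The right derivative suffices: with continuity of the orbit, it is all that the fundamental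
theorem of calculus needs in `integral_eq_sub`. -/
theorem IsC0Semigroup.hasDerivWithinAt_Ioi (hT : IsC0Semigroup T) {x y : E}
    (hxy : Tendsto (diffQuot T x) (𝓝[>] 0) (𝓝 y)) {s : ℝ} (hs : 0 ≤ s) :
    HasDerivWithinAt (fun s : ℝ => T s.toNNReal x) (T s.toNNReal y) (Set.Ioi s) s := by
  rw [hasDerivWithinAt_iff_tendsto_slope' Set.self_notMem_Ioi]
  have hsub : Tendsto (fun r : ℝ => r - s) (𝓝[>] s) (𝓝[>] 0) := by
    refine tendsto_nhdsWithin_iff.2 ⟨?_, ?_⟩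
    · have : Tendsto (fun r : ℝ => r - s) (𝓝 s) (𝓝 (s - s)) :=
        (continuous_id.sub continuous_const).tendsto s
      rw [sub_self] at this
      exact this.mono_left nhdsWithin_le_nhds
    · filter_upwards [self_mem_nhdsWithin] with r hr using Set.mem_Ioi.2 (sub_pos.2 (Set.mem_Ioi.1 hr))
  refine (((hT.tendsto_diffQuot_apply hxy s.toNNReal).comp tendsto_toNNReal_nhdsGT_zero).comp
    hsub).congr' ?_
  filter_upwards [self_mem_nhdsWithin] with r hr
  have hr' : 0 ≤ r - s := (sub_pos.2 hr).le
  simp only [Function.comp, diffQuot, slope_def_module, ← hT.add_apply]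
  rw [Real.coe_toNNReal _ hr', ← Real.toNNReal_add hr' hs, sub_add_cancel]

theorem IsC0Semigroup.integral_eq_sub [CompleteSpace E] (hT : IsC0Semigroup T) {x y : E}
    (hxy : Tendsto (diffQuot T x) (𝓝[>] 0) (𝓝 y)) {t : ℝ} (ht : 0 ≤ t) :
    ∫ s in (0 : ℝ)..t, T s.toNNReal y = T t.toNNReal x - x := by
  have := intervalIntegral.integral_eq_sub_of_hasDeriv_right_of_le ht
    (hT.continuous_toNNReal x).continuousOn
    (fun s hs => hT.hasDerivWithinAt_Ioi hxy hs.1.le)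
    ((hT.continuous_toNNReal y).intervalIntegrable 0 t)
  simpa [hT.zero_apply] using this

theorem tendsto_inv_smul_integral [CompleteSpace E] {u : ℝ → E} (hu : Continuous u) (a : ℝ) :
    Tendsto (fun h : ℝ => h⁻¹ • ∫ s in a..(a + h), u s) (𝓝[>] 0) (𝓝 (u a)) := by
  have h := (hu.integral_hasStrictDerivAt a a).hasDerivAt.tendsto_slope_zero_right
  simpa using h

/-- The graph of the generator is closed, in terms of difference quotients. -/
theorem IsC0Semigroup.tendsto_diffQuot_of_tendsto [CompleteSpace E] (hT : IsC0Semigroup T)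
    {x y : ℕ → E} {x₀ y₀ : E} (hxy : ∀ n, Tendsto (diffQuot T (x n)) (𝓝[>] 0) (𝓝 (y n)))
    (hx : Tendsto x atTop (𝓝 x₀)) (hy : Tendsto y atTop (𝓝 y₀)) :
    Tendsto (diffQuot T x₀) (𝓝[>] 0) (𝓝 y₀) := by
  -- The integral identity, unlike the derivative, survives the limit in `n`; dividing it by `t`
  -- recovers the derivative at 0.
  have hint : ∀ t : ℝ, 0 ≤ t → ∫ s in (0 : ℝ)..t, T s.toNNReal y₀ = T t.toNNReal x₀ - x₀ := by
    intro t ht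
    obtain ⟨C, hC, hTC⟩ := hT.exists_norm_le t.toNNReal
    refine tendsto_nhds_unique (f := fun n => ∫ s in (0 : ℝ)..t, T s.toNNReal (y n))
      (l := atTop) ?_ ?_
    · rw [tendsto_iff_norm_sub_tendsto_zero]
      have hlim : Tendsto (fun n => C * ‖y n - y₀‖ * |t - 0|) atTop (𝓝 0) := by
        simpa using ((tendsto_iff_norm_sub_tendsto_zero.1 hy).const_mul C).mul_const |t - 0|
      refine squeeze_zero (fun _ => norm_nonneg _) (fun n => ?_) hlim
      rw [← intervalIntegral.integral_sub ((hT.continuous_toNNReal _).intervalIntegrable _ _)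
        ((hT.continuous_toNNReal _).intervalIntegrable _ _)]
      refine intervalIntegral.norm_integral_le_of_norm_le_const fun s hs => ?_
      rw [Set.uIoc_of_le ht] at hs
      rw [← map_sub]
      exact (T _).le_of_opNorm_le (hTC _ (Real.toNNReal_le_toNNReal hs.2)) _
    · simp_rw [fun n => hT.integral_eq_sub (hxy n) ht]
      exact (((T _).continuous.tendsto x₀).comp hx).sub hx
  have h := (tendsto_inv_smul_integral (hT.continuous_toNNReal y₀) 0).comp tendsto_coe_nhdsGT_zero
  rw [Real.toNNReal_zero, hT.zero_apply] at h
  refine h.congr fun t => ?_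
  simp only [Function.comp, zero_add, diffQuot]
  rw [hint t t.2, Real.toNNReal_coe]

/-- `T r` shifts the interval of integration by `r`, so only averages over two end pieces of length
`r` remain. -/
theorem IsC0Semigroup.tendsto_diffQuot_integral [CompleteSpace E] (hT : IsC0Semigroup T) (x : E)
    {t : ℝ} (ht : 0 ≤ t) :
    Tendsto (diffQuot T (∫ s in (0 : ℝ)..t, T s.toNNReal x)) (𝓝[>] 0)
      (𝓝 (T t.toNNReal x - x)) := by
  have hu := hT.continuous_toNNReal x
  have h := ((tendsto_inv_smul_integral hu t).sub (tendsto_inv_smul_integral hu 0)).comp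
    tendsto_coe_nhdsGT_zero
  rw [Real.toNNReal_zero, hT.zero_apply] at h
  refine h.congr fun r => ?_
  have hi : ∀ a b, IntervalIntegrable (fun s : ℝ => T s.toNNReal x) MeasureTheory.volume a b :=
    fun a b => hu.intervalIntegrable a b
  have hshift : T r (∫ s in (0 : ℝ)..t, T s.toNNReal x)
      = ∫ s in (r : ℝ)..(t + r), T s.toNNReal x := by
    rw [← ContinuousLinearMap.intervalIntegral_comp_comm _ (hi _ _)]
    have h2 := intervalIntegral.integral_comp_add_right (a := 0) (b := t)
      (fun s : ℝ => T s.toNNReal x) (r : ℝ)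
    rw [zero_add] at h2
    rw [← h2]
    refine intervalIntegral.integral_congr fun s hs => ?_
    rw [Set.uIcc_of_le ht] at hs
    rw [Real.toNNReal_add hs.1 r.coe_nonneg, Real.toNNReal_coe, add_comm, hT.add_apply]
  simp only [Function.comp, zero_add, diffQuot, ← smul_sub]
  rw [hshift]
  congr 1
  have h1 := intervalIntegral.integral_add_adjacent_intervals (hi 0 r) (hi r (t + r))
  have h2 := intervalIntegral.integral_add_adjacent_intervals (hi 0 t) (hi t (t + r))
  rw [eq_sub_of_add_eq' h1, eq_sub_of_add_eq' h2]
  abel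

/-- The domain of the generator is dense. -/
theorem IsC0Semigroup.dense_generatorDomain [CompleteSpace E] (hT : IsC0Semigroup T) :
    Dense (generatorDomain T : Set E) := by
  intro x
  have h := tendsto_inv_smul_integral (hT.continuous_toNNReal x) 0
  rw [Real.toNNReal_zero, hT.zero_apply] at h
  refine mem_closure_of_tendsto h ?_
  filter_upwards [self_mem_nhdsWithin] with t ht
  have hmem : ∫ s in (0 : ℝ)..(0 + t), T s.toNNReal x ∈ generatorDomain T := by
    rw [zero_add]
    exact ⟨_, hT.tendsto_diffQuot_integral x (le_of_lt ht)⟩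
  have := (generatorDomain T).smul_mem ((t⁻¹ : ℝ) : ℂ) hmem
  rwa [Complex.coe_smul] at this

/-! ### Uniform consistency on the graph -/

/-- The graph of the generator, as a subspace of `E × E`. -/
def generatorGraph (T : ℝ≥0 → E →L[ℂ] E) : Submodule ℂ (E × E) where
  carrier := {p | Tendsto (diffQuot T p.1) (𝓝[>] 0) (𝓝 p.2)}
  add_mem' {p q} hp hq := by
    change Tendsto (diffQuot T (p.1 + q.1)) _ (𝓝 (p.2 + q.2))
    rw [diffQuot_add]
    exact Tendsto.add hp hq
  zero_mem' := by
    have h : diffQuot T (0 : E) = fun _ => 0 := by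
      funext t
      simp [diffQuot]
    change Tendsto (diffQuot T (0 : E)) _ (𝓝 0)
    rw [h]
    exact tendsto_const_nhds
  smul_mem' c p hp := by
    change Tendsto (diffQuot T (c • p.1)) _ (𝓝 (c • p.2))
    rw [diffQuot_smul]
    exact Tendsto.const_smul hp c

theorem IsC0Semigroup.isClosed_generatorGraph [CompleteSpace E] (hT : IsC0Semigroup T) :
    IsClosed (generatorGraph T : Set (E × E)) := by
  refine IsSeqClosed.isClosed fun p p₀ hp hlim => ?_
  exact hT.tendsto_diffQuot_of_tendsto hp ((continuous_fst.tendsto p₀).comp hlim)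
    ((continuous_snd.tendsto p₀).comp hlim)

/-- The operator `(F(h) - T(h)) / h`, on the graph of the generator of `T`. -/
noncomputable def graphDiffQuot (F T : ℝ≥0 → E →L[ℂ] E) (h : ℝ≥0) : generatorGraph T →L[ℂ] E :=
  ((h : ℂ)⁻¹ • (F h - T h)).comp
    ((ContinuousLinearMap.fst ℂ E E).comp (generatorGraph T).subtypeL)

theorem graphDiffQuot_apply (F T : ℝ≥0 → E →L[ℂ] E) (h : ℝ≥0) (g : generatorGraph T) :
    graphDiffQuot F T h g = diffQuot F g.1.1 h - diffQuot T g.1.1 h := by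
  simp only [graphDiffQuot, diffQuot, ← smul_sub, sub_sub_sub_cancel_right]
  rw [← Complex.coe_smul]
  simp

/-- On the orbit of an element of the domain, the difference quotients of `F` and `T` approach each
other uniformly in bounded time. -/
theorem IsC0Semigroup.eventually_norm_sub_le [CompleteSpace E] (hT : IsC0Semigroup T)
    {F : ℝ≥0 → E →L[ℂ] E}
    (hF : ∀ p ∈ generatorGraph T, Tendsto (diffQuot F p.1) (𝓝[>] 0) (𝓝 p.2))
    {x : E} (hx : x ∈ generatorDomain T) (b : ℝ≥0) {ε : ℝ} (hε : 0 < ε) :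
    ∀ᶠ h in 𝓝[>] (0 : ℝ≥0), ∀ s ≤ b, ‖F h (T s x) - T h (T s x)‖ ≤ h * ε := by
  obtain ⟨y, hy⟩ := hx
  have : CompleteSpace (generatorGraph T) := hT.isClosed_generatorGraph.completeSpace_coe
  have hlim (g : generatorGraph T) :
      Tendsto (fun h => graphDiffQuot F T h g) (𝓝[>] 0) (𝓝 0) := by
    simp_rw [graphDiffQuot_apply]
    rw [← sub_self g.1.2]
    exact (hF g g.2).sub g.2
  let orbit : ℝ≥0 → generatorGraph T := fun s => ⟨(T s x, T s y), hT.tendsto_diffQuot_apply hy s⟩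
  have horbit : Continuous orbit :=
    ((hT.continuous x).prodMk (hT.continuous y)).subtype_mk _
  filter_upwards [eventually_forall_norm_lt_of_isCompact hlim
    ((isCompact_Icc (a := 0) (b := b)).image horbit) hε, self_mem_nhdsWithin] with h hh hpos s hs
  have hpos' : (0 : ℝ) < h := hpos
  have h1 := hh (orbit s) ⟨s, ⟨zero_le, hs⟩, rfl⟩
  rw [graphDiffQuot_apply] at h1
  simp only [diffQuot, ← smul_sub, sub_sub_sub_cancel_right] at h1
  rw [norm_smul, norm_inv, Real.norm_of_nonneg hpos'.le, inv_mul_lt_iff₀ hpos'] at h1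
  exact h1.le

end Semigroup

end C0

/-! ### Telescoping and the product formula -/

/-- `P^n - Q^n = ∑ P^(n-1-k) (P - Q) Q^k` without commutation; `P - Q` is met only on the `Q`-orbit
of `x`. -/
theorem norm_pow_sub_pow_apply_le {E : Type*} [NormedAddCommGroup E] [NormedSpace ℂ E]
    (P Q : E →L[ℂ] E) (x : E) (n : ℕ) {K δ : ℝ} (hP : ∀ k ≤ n, ‖P ^ k‖ ≤ K)
    (hPQ : ∀ k < n, ‖P ((Q ^ k) x) - Q ((Q ^ k) x)‖ ≤ δ) :
    ‖(P ^ n) x - (Q ^ n) x‖ ≤ n * (K * δ) := by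
  have htel : (P ^ n) x - (Q ^ n) x
      = ∑ k ∈ Finset.range n, (P ^ (n - 1 - k)) (P ((Q ^ k) x) - Q ((Q ^ k) x)) := by
    have h := Finset.sum_range_sub' (fun k => (P ^ (n - k)) ((Q ^ k) x)) n
    simp only [Nat.sub_zero, pow_zero, Nat.sub_self, one_apply_eq_self] at h
    rw [← h]
    refine Finset.sum_congr rfl fun k hk => ?_
    have hk := Finset.mem_range.1 hk
    rw [map_sub]
    congr 1
    · rw [show n - k = (n - 1 - k) + 1 by omega, pow_succ]
      rfl
    · rw [show n - (k + 1) = n - 1 - k by omega, pow_succ' Q]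
      rfl
  rw [htel]
  calc _ ≤ ∑ k ∈ Finset.range n, K * δ := by
        refine norm_sum_le_of_le _ fun k hk => ?_
        exact (P ^ (n - 1 - k)).le_of_opNorm_le_of_le (hP _ (by omega))
          (hPQ k (Finset.mem_range.1 hk))
    _ = n * (K * δ) := by simp

theorem mainTheorem2 {E : Type*} [NormedAddCommGroup E] [NormedSpace ℂ E] [CompleteSpace E]
    (F : ℝ≥0 → E →L[ℂ] E) (hF0 : F 0 = ContinuousLinearMap.id ℂ E)
    (M ω : ℝ) (hM : 1 ≤ M) (hω : 0 ≤ ω)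
    (hF : ∀ t : ℝ≥0, ∀ k : ℕ, 1 ≤ k → ‖F t ^ k‖ ≤ M * Real.exp ((k : ℝ) * ω * (t : ℝ)))
    (T : ℝ≥0 → E →L[ℂ] E) (hT : C0.IsC0Semigroup T)
    (A : E →ₗ.[ℂ] E) (hA : A = C0.generator T)
    (hFA : ∀ x : A.domain, Tendsto (C0.diffQuot F (x : E)) (𝓝[>] 0) (𝓝 (A x))) :
    ∀ x : E, ∀ a b : ℝ≥0,
      TendstoUniformlyOn (fun (n : ℕ) (t : ℝ≥0) => (F (t / (n : ℝ≥0)) ^ n) x)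
        (fun t : ℝ≥0 => T t x) atTop (Set.Icc a b) := by
  intro x a b
  subst hA
  have hgraph : ∀ p ∈ C0.generatorGraph T,
      Tendsto (C0.diffQuot F p.1) (𝓝[>] 0) (𝓝 p.2) := by
    intro p hp
    have h := hFA ⟨p.1, (C0.mem_generator_domain T p.1).2 ⟨p.2, hp⟩⟩
    rwa [tendsto_nhds_unique (C0.tendsto_generator T ⟨p.1, ⟨p.2, hp⟩⟩) hp] at h
  set K : ℝ := M * Real.exp (ω * b) with hK
  have hM0 : 0 < M := by linarith
  have hK0 : 0 < K := by positivity
  have hFK : ∀ n : ℕ, n ≠ 0 → ∀ t ≤ b, ∀ k ≤ n, ‖F (t / n) ^ k‖ ≤ K := by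
    intro n hn t ht k hk
    have hn0 : (0 : ℝ) < n := by positivity
    rcases Nat.eq_zero_or_pos k with rfl | hk0
    · rw [pow_zero, ContinuousLinearMap.one_def]
      refine ContinuousLinearMap.norm_id_le.trans (hM.trans ?_)
      exact le_mul_of_one_le_right hM0.le (Real.one_le_exp (by positivity))
    · refine (hF _ k hk0).trans ?_
      refine mul_le_mul_of_nonneg_left (Real.exp_le_exp.2 ?_) hM0.le
      have hkt : (k : ℝ) * (t / n) ≤ b := by
        rw [mul_div_assoc', div_le_iff₀ hn0, mul_comm (b : ℝ)]
        exact mul_le_mul (Nat.cast_le.2 hk) (NNReal.coe_le_coe.2 ht) t.2 hn0.le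
      push_cast
      calc (k : ℝ) * ω * (t / n) = ω * (k * (t / n)) := by ring
        _ ≤ ω * b := mul_le_mul_of_nonneg_left hkt hω
  obtain ⟨C, hC, hTC⟩ := hT.exists_norm_le b
  rw [Metric.tendstoUniformlyOn_iff]
  intro ε hε
  obtain ⟨z, hz, hxz⟩ := Metric.dense_iff.1 hT.dense_generatorDomain x (ε / (2 * (K + C)))
    (by positivity)
  rw [Metric.mem_ball, dist_eq_norm, norm_sub_rev] at hz
  -- Chosen so that `(b + 1) * K * η = ε / 4`; `b + 1` replaces `b` to allow `b = 0`.
  set η : ℝ := ε / (4 * (K * (b + 1))) with hη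
  have hη0 : 0 < η := by positivity
  obtain ⟨δ, hδ, hball⟩ :=
    Metric.eventually_nhds_iff.1 (eventually_nhdsWithin_iff.1
      (hT.eventually_norm_sub_le hgraph hxz b hη0))
  have hlarge : ∀ᶠ n : ℕ in atTop, (b : ℝ) / δ < n :=
    tendsto_natCast_atTop_atTop.eventually_gt_atTop _
  filter_upwards [hlarge, eventually_ne_atTop 0] with n hn hn0 t ht
  have htb : t ≤ b := ht.2
  have hnpos : (0 : ℝ) < n := by positivity
  have hnn : (n : ℝ≥0) ≠ 0 := Nat.cast_ne_zero.2 hn0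
  have hTt : T t = T (t / n) ^ n := by
    rw [← hT.natCast_mul, mul_div_cancel₀ _ hnn]
  have hzt : ‖(F (t / n) ^ n) z - T t z‖ ≤ ε / 4 := by
    rw [hTt]
    have hstep : ∀ k < n, ‖F (t / n) ((T (t / n) ^ k) z) - T (t / n) ((T (t / n) ^ k) z)‖
        ≤ ((t / n : ℝ≥0) : ℝ) * η := by
      intro k hk
      rw [← hT.natCast_mul]
      have hkt : (k : ℝ≥0) * (t / n) ≤ b := by
        calc (k : ℝ≥0) * (t / n) ≤ n * (t / n) := by gcongr
          _ = t := mul_div_cancel₀ _ hnn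
          _ ≤ b := htb
      -- The estimate holds only for positive step; at step 0 both operators are the identity.
      rcases (zero_le (a := t / n)).eq_or_lt with h0 | hpos
      · simp [← h0, hF0, hT.zero]
      · refine hball ?_ hpos _ hkt
        rw [NNReal.dist_eq]
        push_cast
        rw [sub_zero, abs_of_nonneg (by positivity), div_lt_iff₀ hnpos]
        rw [div_lt_iff₀ hδ] at hn
        have : (t : ℝ) ≤ b := htb
        linarith
    refine (norm_pow_sub_pow_apply_le _ _ z n (hFK n hn0 t htb) hstep).trans ?_
    have : (t : ℝ) ≤ b + 1 := (NNReal.coe_le_coe.2 htb).trans (by linarith)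
    calc (n : ℝ) * (K * (((t / n : ℝ≥0) : ℝ) * η)) = t * (K * η) := by
          push_cast; field_simp
      _ ≤ (b + 1) * (K * η) := by gcongr
      _ = ε / 4 := by
          have : (b : ℝ) + 1 ≠ 0 := by positivity
          rw [hη]; field_simp
  rw [dist_comm, dist_eq_norm]
  have hsplit : (F (t / n) ^ n) x - T t x
      = (F (t / n) ^ n) (x - z) + ((F (t / n) ^ n) z - T t z) - T t (x - z) := by
    rw [map_sub, map_sub]; abel
  have h1 := (F (t / n) ^ n).le_of_opNorm_le (hFK n hn0 t htb n le_rfl) (x - z)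
  have h2 := (T t).le_of_opNorm_le (hTC t htb) (x - z)
  have h3 : (K + C) * ‖x - z‖ < ε / 2 := by
    calc (K + C) * ‖x - z‖ < (K + C) * (ε / (2 * (K + C))) := by gcongr
      _ = ε / 2 := by field_simp
  rw [hsplit]
  refine (norm_sub_le _ _).trans_lt ?_
  have h4 := norm_add_le ((F (t / n) ^ n) (x - z)) ((F (t / n) ^ n) z - T t z)
  linarith
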